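/- **Setting.** Let $M$ be a metric space with origin $o\in M$ in which any two points $a,b$ are joined by a shortest path, an isometric curve of length $d(a,b)$; one such path is fixed for each ordered pair $(a,b)$ and the server moves along these paths. In the (non-preemptive, uncapacitated) online dial-a-ride problem the input is a finite sequence $\mathbf x=(x_1,\dots,x_n)$, $n\ge 0$, of requests $x_i=(t_i,a_i,b_i)$ with $0\le t_1\le\dots\le t_n$: at time $t_i$ the request $x_i$ becomes known, and it has to be picked up at $a_i$, not before time $t_i$, and later delivered at $b_i$. A unit-speed server of unlimited capacity starts at $o$ at time $0$ and has to serve all requests and return to $o$; the completion time is to be minimized. A *route* for $\mathbf x$ is an order of the $2n$ pickups and deliveries with each pickup before the corresponding delivery; a server that *follows* it from $o$ starting at time $s$ moves along shortest paths from stop to stop and finally back to $o$, waits at a pickup until the request's arrival time if it gets there earlier, and does not wait otherwise. $Z^{OPT}$ is the least completion time of a route for $\mathbf x$ started at time $0$. The server is given in advance a predicted request sequence $\hat{\mathbf x}$ of arbitrary size $m\ge 0$. **The algorithm LADAR-NID** with confidence level $\lambda\in(0,1]$. Let $\hat T$ be an optimal route for $\hat{\mathbf x}$ without superfluous movement: among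 the routes for $\hat{\mathbf x}$ with the least completion time $|\hat T|$ (started at time $0$, with the predicted arrival times) it has the least travelled distance. At time $t$ let $U_t$ be the set of known requests not yet delivered. When the server is at $o$ and plans at time $t$ with $U_t\ne\emptyset$, let $T_{U_t}$ be a shortest closed tour from $o$ that performs the remaining pickups and deliveries of $U_t$ (requests on board only need delivery), and $|T_{U_t}|$ its length. Whenever the server returns to $o$ it keeps its load on board. 1. While $t<\lambda|\hat T|$: the server waits at $o$ while $U_t=\emptyset$. If it is at $o$ and $U_t\neq\emptyset$, it starts to follow $T_{U_t}$; if $t+|T_{U_t}|>\lambda|\hat T|$, it leaves this tour at a moment $t_{back}\in[t,t+|T_{U_t}|]$ with $t_{back}+d(p(t_{back}),o)=\lambda|\hat T|$, where $p$ denotes its position on the tour, and goes directly home, arriving at time $\lambda|\hat T|$. If a new request arrives while it is on a tour, it immediately goes back to $o$ and plans again. 2. From time $\lambda|\hat T|$ on: the server, which is at $o$, waits until $U_t\ne\emptyset$ and then follows $\hat T$ once, from that time on (with the predicted arrival times), until its end at $o$, without interruption, thereby serving the actual requests that occur in $\hat{\mathbf x}$. 3. Afterwards it uses the Redesign strategy: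 at $o$ it waits while $U_t=\emptyset$ and otherwise follows some $T_{U_t}$; when a new request arrives while it is on a tour, it immediately goes back to $o$ and plans again. $Z^{ALG}$ is the time at which, having served all of $\mathbf x$, the server gets back to $o$ at the end of the tour or route it is following, or of its direct way home ($Z^{ALG}=0$ if $n=0$). **Notions.** The error is $\varepsilon=0$ if $\hat{\mathbf x}=\mathbf x$ and $\varepsilon=1$ otherwise (only the presence of an error is measured). An algorithm is $\alpha$-consistent if $Z^{ALG}\le\alpha Z^{OPT}$ on all instances (in all spaces $M$ as above) with $\varepsilon=0$; it is $\beta$-robust if $Z^{ALG}\le\beta Z^{OPT}$ on all instances, whatever the prediction; an $\alpha$-consistent algorithm is smooth if there is a continuous $f:\mathbb R\to\mathbb R$ with $f(0)=0$ such that $Z^{ALG}\le\alpha Z^{OPT}+f(\varepsilon)$ on all instances. **Theorem.** Let $\lambda\in(0,1]$. LADAR-NID is well defined: it can be carried out and completes on every instance. For every way of making the choices it leaves open (among the routes $\hat T$, the tours $T_{U_t}$ and the moments $t_{back}$), it is $(1.5+\lambda)$-consistent and $(3.5+2.5/\lambda)$-robust, but it is not smooth: for $\alpha=1.5+\lambda$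 there is no function $f$ as above. -/

import Mathlib

universe u

noncomputable section

namespace DialARide

/-- A ride: it becomes known at `time` and has to be moved from `source` to `target`. -/
@[ext]
structure Request (M : Type u) where
  time : ℝ
  source : M
  target : M

/-- The two things a server does for each of `n` requests. -/
inductive Stop (n : ℕ) : Type
  | pickup (i : Fin n) : Stop n
  | deliver (i : Fin n) : Stop n

/-- The request a stop belongs to. -/
def Stop.index {n : ℕ} : Stop n → Fin n
  | .pickup i => i
  | .deliver i => i

/-- A choice of shortest paths: `path a b s` is the position of a unit-speed server that left `a`
for `b` and has travelled the distance `s`. -/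
structure PathSystem (M : Type u) [MetricSpace M] where
  path : M → M → ℝ → M
  path_zero : ∀ a b, path a b 0 = a
  path_dist : ∀ a b, path a b (dist a b) = b
  dist_path : ∀ a b, ∀ s ∈ Set.Icc 0 (dist a b), ∀ t ∈ Set.Icc 0 (dist a b),
    dist (path a b s) (path a b t) = |s - t|

section Routes

variable {M : Type u} [MetricSpace M]

/-- The place of a stop, for the request sequence `x`. -/
def place (x : List (Request M)) : Stop x.length → M
  | .pickup i => (x.get i).source
  | .deliver i => (x.get i).target

/-- The release time of a request restricts when it can be picked up; there is no restriction on
deliveries (apart from the pickup being earlier). -/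
def earliest (x : List (Request M)) (τ : ℝ) : Stop x.length → ℝ
  | .pickup i => max τ (x.get i).time
  | .deliver _ => τ

/-- `r` is an order in which to perform exactly the stops not in `S` of the requests in `A`, each
once and no delivery before the corresponding pickup. Unlimited capacity, no preemption. -/
structure IsRoute {n : ℕ} (A : Set (Fin n)) (S : Set (Stop n)) (r : List (Stop n)) : Prop where
  nodup : r.Nodup
  mem_iff : ∀ σ, σ ∈ r ↔ σ.index ∈ A ∧ σ ∉ S
  order : r.Pairwise fun σ τ => ∀ i, ¬ (σ = .deliver i ∧ τ = .pickup i)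

/-- The time at which a unit-speed server that is at `p` at time `τ` is back at the origin `o` if it
performs the stops of the route in order, at each pickup waiting for the release time if
necessary, and not waiting otherwise. -/
def finishTime (o : M) (x : List (Request M)) : M → ℝ → List (Stop x.length) → ℝ
  | p, τ, [] => τ + dist p o
  | p, τ, σ :: r => finishTime o x (place x σ) (earliest x (τ + dist p (place x σ)) σ) r

/-- The distance travelled from `p` through the stops of the route and then to the origin. -/
def travel (o : M) (x : List (Request M)) : M → List (Stop x.length) → ℝ
  | p, [] => dist p o
  | p, σ :: r => dist p (place x σ) + travel o x (place x σ) r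

/-- The position of a server that has travelled the distance `s` from `p` through the stops of the
route and then to the origin. -/
def positionAt (γ : PathSystem M) (o : M) (x : List (Request M)) :
    M → List (Stop x.length) → ℝ → M
  | p, [], s => γ.path p o s
  | p, σ :: r, s =>
    if s ≤ dist p (place x σ) then γ.path p (place x σ) s
    else positionAt γ o x (place x σ) r (s - dist p (place x σ))

/-- The stops performed by a server that has travelled the distance `s` from `p` along the route. -/
def performed (x : List (Request M)) : M → List (Stop x.length) → ℝ → Set (Stop x.length)
  | _, [], _ => ∅
  | p, σ :: r, s =>
    if dist p (place x σ) ≤ s then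
      insert σ (performed x (place x σ) r (s - dist p (place x σ)))
    else ∅

/-- The offline optimum `Z^OPT`: the least completion time of a route that starts at the origin at
time `0` and serves all of `x`, respecting release times. -/
def optCost (o : M) (x : List (Request M)) : ℝ :=
  sInf {z | ∃ r : List (Stop x.length), IsRoute Set.univ ∅ r ∧ z = finishTime o x o 0 r}

/-- `r` is an optimal route for `x` (with release times): it completes as early as possible and,
among the routes that do, has no superfluous movement, that is, its travelled distance is least. -/
structure IsOptimalRoute (o : M) (x : List (Request M)) (r : List (Stop x.length)) : Prop where
  route : IsRoute Set.univ ∅ r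
  earliest : ∀ r', IsRoute Set.univ ∅ r' → finishTime o x o 0 r ≤ finishTime o x o 0 r'
  shortest : ∀ r', IsRoute Set.univ ∅ r' → finishTime o x o 0 r' = finishTime o x o 0 r →
    travel o x o r ≤ travel o x o r'

/-- The requests known at time `t`. -/
def released (x : List (Request M)) (t : ℝ) : Set (Fin x.length) :=
  {i | (x.get i).time ≤ t}

/-- `U_t`: the known requests not delivered yet, `S` being the set of stops performed so far. -/
def unserved (x : List (Request M)) (t : ℝ) (S : Set (Stop x.length)) : Set (Fin x.length) :=
  {i | (x.get i).time ≤ t ∧ Stop.deliver i ∉ S}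

/-- `r` is an optimal route `T_{U_t}` for a server at the origin at time `t`: a shortest closed tour
through the remaining stops of the known requests. A request that has been picked up but not
delivered is on board and only has a delivery stop left. -/
structure IsOptimalTour (o : M) (x : List (Request M)) (t : ℝ) (S : Set (Stop x.length))
    (r : List (Stop x.length)) : Prop where
  route : IsRoute (released x t) S r
  shortest : ∀ r', IsRoute (released x t) S r' → travel o x o r ≤ travel o x o r'

/-- `t'` is the first time after `t` at which a request arrives. -/
def IsNextArrival (x : List (Request M)) (t t' : ℝ) : Prop :=
  t < t' ∧ (∃ i, (x.get i).time = t') ∧ ∀ i, t < (x.get i).time → t' ≤ (x.get i).time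

/-- The smaller of `e` and the first arrival time after `t`. -/
def leaveTime (x : List (Request M)) (t e : ℝ) : ℝ :=
  ((x.map Request.time).filter fun s => t < s).foldr min e

/-- When the server at the origin at time `t < B` has computed the tour `r`, it plans to follow it
until time `e` and then to go home directly: `e` is the end of the tour if the tour ends by the
deadline `B`, and otherwise a moment `e = t_back` from which it gets home exactly at time `B`. -/
def IsPlannedEnd (γ : PathSystem M) (o : M) (x : List (Request M)) (B t : ℝ)
    (r : List (Stop x.length)) (e : ℝ) : Prop :=
  (t + travel o x o r ≤ B ∧ e = t + travel o x o r) ∨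
  (B < t + travel o x o r ∧ e ∈ Set.Icc t (t + travel o x o r) ∧
    e + dist (positionAt γ o x o r (e - t)) o = B)

/-- `early`: before time `λ|T̂|`; `predicted`: waiting to follow, or following, the predicted route;
`late`: after having followed it. -/
inductive Phase : Type
  | early : Phase
  | predicted : Phase
  | late : Phase

/-- Executions of LADAR-NID with deadline `B = λ|T̂|` and predicted route `That` for `xhat`.
`Run … φ t S z` says: a server that is at the origin at time `t` in phase `φ`, after having performed
the stops in `S`, can complete at time `z`, that is, `z` is the time at which it gets back to the
origin with all requests served. -/
inductive Run (γ : PathSystem M) (o : M) (xhat x : List (Request M)) (B : ℝ)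
    (That : List (Stop xhat.length)) : Phase → ℝ → Set (Stop x.length) → ℝ → Prop
  /-- Everything is served. -/
  | done {φ t S} (h : ∀ i, Stop.deliver i ∈ S) : Run γ o xhat x B That φ t S t
  /-- Before time `B`: wait at the origin while there is nothing to serve. -/
  | earlyWait {t t' S z} (ht : t < B) (hU : unserved x t S = ∅) (hn : IsNextArrival x t t')
      (h : t' < B) (next : Run γ o xhat x B That .early t' S z) :
      Run γ o xhat x B That .early t S z
  | earlyIdle {t t' S z} (ht : t < B) (hU : unserved x t S = ∅) (hn : IsNextArrival x t t')
      (h : B ≤ t') (next : Run γ o xhat x B That .early B S z) :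
      Run γ o xhat x B That .early t S z
  /-- Before time `B`, with unserved requests: compute an optimal tour and follow it to its planned
  end or to the next arrival, whichever comes first; then go to the origin, with the load. -/
  | earlyTour {t S r e z} (ht : t < B) (hU : (unserved x t S).Nonempty)
      (hr : IsOptimalTour o x t S r) (he : IsPlannedEnd γ o x B t r e)
      (next : Run γ o xhat x B That .early
        (leaveTime x t e + dist (positionAt γ o x o r (leaveTime x t e - t)) o)
        (S ∪ performed x o r (leaveTime x t e - t)) z) :
      Run γ o xhat x B That .early t S z
  /-- Time `B` is reached. -/
  | switch {t S z} (ht : B ≤ t) (next : Run γ o xhat x B That .predicted t S z) :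
      Run γ o xhat x B That .early t S z
  /-- From time `B` on: wait until there is an unserved request. -/
  | predictedWait {t t' S z} (hU : unserved x t S = ∅) (hn : IsNextArrival x t t')
      (next : Run γ o xhat x B That .predicted t' S z) :
      Run γ o xhat x B That .predicted t S z
  /-- Follow the predicted route until it is back at the origin; on it, the actual requests that
  were predicted are served (they are released when the predicted pickup is performed, since the
  server waits there for the predicted release time). -/
  | follow {t S z} (hU : (unserved x t S).Nonempty)
      (next : Run γ o xhat x B That .late (finishTime o xhat o t That)
        (S ∪ {σ | x.get σ.index ∈ xhat}) z) :
      Run γ o xhat x B That .predicted t S z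
  /-- Afterwards, the Redesign strategy: wait at the origin if there is nothing to serve. -/
  | lateWait {t t' S z} (hU : unserved x t S = ∅) (hn : IsNextArrival x t t')
      (next : Run γ o xhat x B That .late t' S z) :
      Run γ o xhat x B That .late t S z
  /-- Otherwise follow an optimal tour, and go to the origin as soon as a request arrives. -/
  | lateTour {t S r z} (hU : (unserved x t S).Nonempty) (hr : IsOptimalTour o x t S r)
      (next : Run γ o xhat x B That .late
        (leaveTime x t (t + travel o x o r)
          + dist (positionAt γ o x o r (leaveTime x t (t + travel o x o r) - t)) o)
        (S ∪ performed x o r (leaveTime x t (t + travel o x o r) - t)) z) :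
      Run γ o xhat x B That .late t S z

/-- `z` is a possible completion time of LADAR-NID with confidence level `lam` on the input `x`
with prediction `xhat`. -/
def LADARNID (γ : PathSystem M) (o : M) (lam : ℝ) (xhat x : List (Request M)) (z : ℝ) : Prop :=
  ∃ That, IsOptimalRoute o xhat That ∧
    Run γ o xhat x (lam * finishTime o xhat o 0 That) That .early 0 ∅ z

/-- Request sequences: non-negative arrival times in non-decreasing order. -/
def IsRequestSequence (x : List (Request M)) : Prop :=
  (∀ r ∈ x, 0 ≤ r.time) ∧ x.Pairwise fun r r' => r.time ≤ r'.time

end Routes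

/-- An instance of the online dial-a-ride problem with a sequence prediction of arbitrary size. -/
structure Input : Type (u + 1) where
  Space : Type u
  [metric : MetricSpace Space]
  paths : PathSystem Space
  origin : Space
  prediction : List (Request Space)
  requests : List (Request Space)
  isSeq_prediction : IsRequestSequence prediction
  isSeq_requests : IsRequestSequence requests

attribute [instance] Input.metric

/-- `Z^OPT` of an instance. -/
def Input.opt (I : Input.{u}) : ℝ := optCost I.origin I.requests

open Classical in
/-- The error of the prediction is not quantified: it only says whether there is one. -/
def Input.error (I : Input.{u}) : ℝ := if I.prediction = I.requests then 0 else 1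

/-- `ALG` gives the completion times of an implementation of LADAR-NID: of an execution, for each
instance, with whatever choices among optimal routes, optimal tours and moments `t_back`. -/
def ImplementsLADARNID (lam : ℝ) (ALG : Input.{u} → ℝ) : Prop :=
  ∀ I : Input.{u}, LADARNID I.paths I.origin lam I.prediction I.requests (ALG I)

/-- Competitive ratio at most `α` whenever the prediction is perfect. -/
def IsConsistent (α : ℝ) (ALG : Input.{u} → ℝ) : Prop :=
  ∀ I : Input.{u}, I.error = 0 → ALG I ≤ α * I.opt

/-- Competitive ratio at most `β` whatever the prediction. -/
def IsRobust (β : ℝ) (ALG : Input.{u} → ℝ) : Prop :=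
  ∀ I : Input.{u}, ALG I ≤ β * I.opt

/-- Smoothness of an `α`-consistent algorithm, for some function of the error. -/
def IsSmooth (α : ℝ) (ALG : Input.{u} → ℝ) : Prop :=
  ∃ f : ℝ → ℝ, Continuous f ∧ f 0 = 0 ∧ ∀ I : Input.{u}, ALG I ≤ α * I.opt + f I.error

end DialARide

end

/-! Let C be the offline optimum and B = λ|T̂|.

Robustness. Arrivals and planned tours are both bounded by C, and a server on a tour is within half
its length of the origin. So an interrupted tour is back by 1.5C (`return_le_of_lt_time`), and one
more tour leads to 2.5C. By then all is delivered or the time is B, so following T̂ requires |T̂| ≤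
(2.5/λ)C. T̂ then ends by (2.5 + 2.5/λ)C, and one last tour costs at most C (`Run.le_of_isRobust`).

Consistency. Now |T̂| = C, and following T̂ serves everything. A start at t ≤ (0.5 + λ)C gives at
most t + C. A later start lies beyond B, so t is an arrival time, and all earlier requests were
delivered by B. Repeating what the server did until B, then serving the rest in the order of T̂, is
again optimal and has length at most B + 2(C - t). As T̂ has least length among optimal routes, it
is at most as long (`IsOptimalRoute.travel_le`), and it ends by max(C, t + B + 2(C - t)).

No smoothness. The error only takes the values 0 and 1, so f(1) is a constant, while the loss on one
misplaced request on the line scales with the instance.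

Well-definedness. There are finitely many routes, t_back comes from the intermediate value theorem,
and the number of pending arrivals bounds the replanning. -/

noncomputable section

namespace DialARide

/-! ### Release times and next arrivals -/

section Arrivals

variable {M : Type u} {x : List (Request M)}

theorem le_earliest (τ : ℝ) (σ : Stop x.length) : τ ≤ earliest x τ σ := by
  cases σ <;> simp [earliest]

theorem earliest_mono {τ τ' : ℝ} (h : τ ≤ τ') (σ : Stop x.length) :
    earliest x τ σ ≤ earliest x τ' σ := by
  cases σ
  · exact max_le_max_right _ h
  · exact h

theorem earliest_add_le {δ : ℝ} (hδ : 0 ≤ δ) (τ : ℝ) (σ : Stop x.length) :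
    earliest x (τ + δ) σ ≤ earliest x τ σ + δ := by
  cases σ
  · refine max_le (add_le_add_left (le_max_left _ _) δ) ?_
    exact (le_max_right _ _).trans (le_add_of_nonneg_right hδ)
  · exact le_rfl

theorem earliest_le_max {τ τ' : ℝ} (σ : Stop x.length) :
    earliest x τ' σ ≤ max (earliest x τ σ) τ' := by
  cases σ
  · exact max_le (le_max_right _ _) (le_max_of_le_left (le_max_right _ _))
  · exact le_max_right _ _

theorem earliest_eq_self {τ : ℝ} {σ : Stop x.length} (h : (x.get σ.index).time ≤ τ) :
    earliest x τ σ = τ := by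
  cases σ
  · exact max_eq_left h
  · rfl

theorem foldr_min_le (l : List ℝ) (e : ℝ) : l.foldr min e ≤ e := by
  induction l with
  | nil => exact le_rfl
  | cons a l ih => exact (min_le_right _ _).trans ih

theorem foldr_min_le_of_mem {l : List ℝ} {a : ℝ} (e : ℝ) (h : a ∈ l) : l.foldr min e ≤ a := by
  induction l with
  | nil => simp at h
  | cons b l ih =>
    rcases List.mem_cons.1 h with rfl | h
    · exact min_le_left _ _
    · exact (min_le_right _ _).trans (ih h)

theorem foldr_min_eq_or_mem (l : List ℝ) (e : ℝ) : l.foldr min e = e ∨ l.foldr min e ∈ l := by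
  induction l with
  | nil => exact Or.inl rfl
  | cons b l ih =>
    rw [List.foldr_cons]
    rcases min_choice b (l.foldr min e) with h | h
    · exact Or.inr (by simp [h])
    · rw [h]
      exact ih.imp id (List.mem_cons_of_mem _)

theorem leaveTime_le (t e : ℝ) : leaveTime x t e ≤ e := foldr_min_le _ _

theorem leaveTime_le_time {t : ℝ} (e : ℝ) {i : Fin x.length} (h : t < (x.get i).time) :
    leaveTime x t e ≤ (x.get i).time := by
  apply foldr_min_le_of_mem
  simp only [List.mem_filter, List.mem_map, decide_eq_true_eq]
  exact ⟨⟨_, List.get_mem x i, rfl⟩, h⟩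

theorem leaveTime_eq_or (t e : ℝ) :
    leaveTime x t e = e ∨ ∃ i, t < (x.get i).time ∧ leaveTime x t e = (x.get i).time := by
  refine (foldr_min_eq_or_mem _ e).imp id fun h => ?_
  simp only [List.mem_filter, List.mem_map, decide_eq_true_eq] at h
  obtain ⟨⟨a, ha, h1⟩, h2⟩ := h
  obtain ⟨i, rfl⟩ := List.get_of_mem ha
  exact ⟨i, by rw [h1]; exact h2, h1.symm⟩

theorem le_leaveTime {t e : ℝ} (h : t ≤ e) : t ≤ leaveTime x t e := by
  rcases leaveTime_eq_or (x := x) t e with h' | ⟨i, hi, h'⟩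
  · rwa [h']
  · rw [h']
    exact hi.le

theorem leaveTime_eq_of_forall_le {t e : ℝ} (h : ∀ i, (x.get i).time ≤ t) :
    leaveTime x t e = e := by
  refine (leaveTime_eq_or t e).resolve_right ?_
  rintro ⟨i, hi, -⟩
  exact (h i).not_gt hi

theorem exists_isNextArrival {t : ℝ} {i : Fin x.length} (h : t < (x.get i).time) :
    ∃ t', IsNextArrival x t t' := by
  obtain ⟨j, hj, hmin⟩ := Set.exists_min_image {j : Fin x.length | t < (x.get j).time}
    (fun j => (x.get j).time) (Set.toFinite _) ⟨i, h⟩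
  exact ⟨_, hj, ⟨j, rfl⟩, hmin⟩

end Arrivals

/-! ### Completion time and length of routes -/

section Routes

variable {M : Type u} [MetricSpace M] {o : M} {x : List (Request M)}

theorem finishTime_mono (r : List (Stop x.length)) :
    ∀ {p : M} {τ τ' : ℝ}, τ ≤ τ' → finishTime o x p τ r ≤ finishTime o x p τ' r := by
  induction r with
  | nil => intro p τ τ' h; simpa [finishTime] using h
  | cons σ r ih => intro p τ τ' h; exact ih (earliest_mono (by linarith) _)

theorem finishTime_add_le (r : List (Stop x.length)) {δ : ℝ} (hδ : 0 ≤ δ) :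
    ∀ (p : M) (τ : ℝ), finishTime o x p (τ + δ) r ≤ finishTime o x p τ r + δ := by
  induction r with
  | nil => intro p τ; simp only [finishTime]; linarith
  | cons σ r ih =>
    intro p τ
    refine le_trans (finishTime_mono r ?_) (ih _ _)
    rw [add_right_comm]
    exact earliest_add_le hδ _ _

/-- Once the server started at `τ'` is no later than the one started at `τ`, it remains so; until
then it never waits. -/
theorem finishTime_le_max (r : List (Stop x.length)) :
    ∀ (p : M) (τ τ' : ℝ),
      finishTime o x p τ' r ≤ max (finishTime o x p τ r) (τ' + travel o x p r) := by
  induction r with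
  | nil => intro p τ τ'; exact le_max_right _ _
  | cons σ r ih =>
    intro p τ τ'
    have h := earliest_le_max (x := x) (τ := τ + dist p (place x σ))
      (τ' := τ' + dist p (place x σ)) σ
    simp only [finishTime, travel]
    rcases le_max_iff.1 h with h | h
    · exact le_max_of_le_left (finishTime_mono r h)
    · refine (ih _ (earliest x (τ + dist p (place x σ)) σ) _).trans (max_le_max_left _ ?_)
      linarith

theorem add_travel_le_finishTime (r : List (Stop x.length)) :
    ∀ (p : M) (τ : ℝ), τ + travel o x p r ≤ finishTime o x p τ r := by
  induction r with
  | nil => intro p τ; exact le_rfl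
  | cons σ r ih =>
    intro p τ
    have h1 := ih (place x σ) (earliest x (τ + dist p (place x σ)) σ)
    have h2 := le_earliest (τ + dist p (place x σ)) σ
    simp only [finishTime, travel]
    linarith

theorem dist_le_travel (r : List (Stop x.length)) :
    ∀ p : M, dist p o ≤ travel o x p r := by
  induction r with
  | nil => intro p; exact le_rfl
  | cons σ r ih =>
    intro p
    have := ih (place x σ)
    have := dist_triangle p (place x σ) o
    simp only [travel]
    linarith

theorem travel_nonneg (r : List (Stop x.length)) (p : M) : 0 ≤ travel o x p r :=
  dist_nonneg.trans (dist_le_travel r p)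

theorem le_finishTime (r : List (Stop x.length)) (p : M) (τ : ℝ) : τ ≤ finishTime o x p τ r := by
  have := add_travel_le_finishTime (o := o) r p τ
  have := travel_nonneg (o := o) r p
  linarith

theorem dist_add_dist_le_travel {r : List (Stop x.length)} {σ : Stop x.length} :
    ∀ {p : M}, σ ∈ r → dist p (place x σ) + dist (place x σ) o ≤ travel o x p r := by
  induction r with
  | nil => simp
  | cons ρ r ih =>
    intro p h
    simp only [travel]
    rcases List.mem_cons.1 h with rfl | h
    · have := dist_le_travel (o := o) r (place x σ)
      linarith
    · have := ih (p := place x ρ) h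
      have := dist_triangle p (place x ρ) (place x σ)
      linarith

theorem travel_le_dist_add (r : List (Stop x.length)) (p q : M) :
    travel o x p r ≤ dist p q + travel o x q r := by
  cases r with
  | nil => exact dist_triangle _ _ _
  | cons σ r =>
    have := dist_triangle p q (place x σ)
    simp only [travel]
    linarith

theorem finishTime_le_of_detour (r : List (Stop x.length)) (p q : M) (τ : ℝ) :
    finishTime o x p τ r ≤ finishTime o x q (τ + dist p q) r := by
  cases r with
  | nil =>
    have := dist_triangle p q o
    simp only [finishTime]
    linarith
  | cons σ r =>
    have := dist_triangle p q (place x σ)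
    exact finishTime_mono r (earliest_mono (by linarith) _)

theorem travel_le_of_sublist {r r' : List (Stop x.length)} (h : r'.Sublist r) :
    ∀ p : M, travel o x p r' ≤ travel o x p r := by
  induction h with
  | slnil => intro p; exact le_rfl
  | cons σ h ih =>
    intro p
    exact (travel_le_dist_add _ _ _).trans (add_le_add_right (ih (place x σ)) _)
  | cons_cons σ h ih =>
    intro p
    exact add_le_add_right (ih (place x σ)) _

/-- A dropped stop can be visited as a mere detour, which the triangle inequality removes; its
waiting time is saved too. -/
theorem finishTime_le_of_sublist {r r' : List (Stop x.length)} (h : r'.Sublist r) :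
    ∀ (p : M) (τ : ℝ), finishTime o x p τ r' ≤ finishTime o x p τ r := by
  induction h with
  | slnil => intro p τ; exact le_rfl
  | cons σ h ih =>
    intro p τ
    exact (finishTime_le_of_detour _ _ _ _).trans
      ((ih (place x σ) _).trans (finishTime_mono _ (le_earliest _ σ)))
  | cons_cons σ h ih =>
    intro p τ
    exact ih (place x σ) _

theorem travel_append_le (r s : List (Stop x.length)) :
    ∀ p : M, travel o x p (r ++ s) ≤ travel o x p r + travel o x o s := by
  induction r with
  | nil => intro p; exact travel_le_dist_add s p o
  | cons σ r ih =>
    intro p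
    have := ih (place x σ)
    simp only [List.cons_append, travel]
    linarith

theorem finishTime_append_le (r s : List (Stop x.length)) :
    ∀ (p : M) (τ : ℝ),
      finishTime o x p τ (r ++ s) ≤ finishTime o x o (finishTime o x p τ r) s := by
  induction r with
  | nil => intro p τ; exact finishTime_le_of_detour s p o τ
  | cons σ r ih => intro p τ; exact ih _ _

theorem time_le_finishTime {r : List (Stop x.length)} {i : Fin x.length} :
    ∀ {p : M} {τ : ℝ}, Stop.pickup i ∈ r → (x.get i).time ≤ finishTime o x p τ r := by
  induction r with
  | nil => simp
  | cons ρ r ih =>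
    intro p τ h
    rcases List.mem_cons.1 h with rfl | h
    · exact (le_max_right _ _).trans (le_finishTime _ _ _)
    · exact ih h

theorem finishTime_eq_add_travel {r : List (Stop x.length)} :
    ∀ {p : M} {τ : ℝ}, (∀ σ ∈ r, (x.get σ.index).time ≤ τ) →
      finishTime o x p τ r = τ + travel o x p r := by
  induction r with
  | nil => intro p τ _; rfl
  | cons σ r ih =>
    intro p τ h
    have h0 : (0 : ℝ) ≤ dist p (place x σ) := dist_nonneg
    have h1 : (x.get σ.index).time ≤ τ + dist p (place x σ) :=
      (h σ (by simp)).trans (by linarith)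
    simp only [finishTime, travel]
    rw [earliest_eq_self h1, ih, add_assoc]
    intro ρ hρ
    exact (h ρ (by simp [hρ])).trans (by linarith)

/-! ### Motion along a route -/

section Position

variable (γ : PathSystem M)

theorem PathSystem.dist_path_left (a b : M) {s : ℝ} (hs : s ∈ Set.Icc 0 (dist a b)) :
    dist a (γ.path a b s) = s := by
  have := γ.dist_path a b 0 ⟨le_rfl, dist_nonneg⟩ s hs
  rwa [γ.path_zero, zero_sub, abs_neg, abs_of_nonneg hs.1] at this

theorem PathSystem.dist_path_right (a b : M) {s : ℝ} (hs : s ∈ Set.Icc 0 (dist a b)) :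
    dist (γ.path a b s) b = dist a b - s := by
  have := γ.dist_path a b s hs (dist a b) ⟨dist_nonneg, le_rfl⟩
  rwa [γ.path_dist, abs_sub_comm, abs_of_nonneg (by linarith [hs.2])] at this

theorem positionAt_zero (p : M) (r : List (Stop x.length)) : positionAt γ o x p r 0 = p := by
  cases r <;> simp [positionAt, γ.path_zero]

theorem positionAt_cons_of_le {p : M} {σ : Stop x.length} {r : List (Stop x.length)} {s : ℝ}
    (h : dist p (place x σ) ≤ s) :
    positionAt γ o x p (σ :: r) s
      = positionAt γ o x (place x σ) r (s - dist p (place x σ)) := by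
  simp only [positionAt]
  -- At equality the definition still uses the first leg; both descriptions give the stop itself.
  split_ifs with h'
  · obtain rfl := le_antisymm h h'
    rw [sub_self, positionAt_zero, γ.path_dist]
  · rfl

theorem positionAt_travel (r : List (Stop x.length)) :
    ∀ p : M, positionAt γ o x p r (travel o x p r) = o := by
  induction r with
  | nil => intro p; exact γ.path_dist p o
  | cons σ r ih =>
    intro p
    have h := travel_nonneg (o := o) r (place x σ)
    rw [positionAt_cons_of_le γ (by simpa [travel] using h)]
    simpa [travel] using ih (place x σ)

theorem dist_positionAt_le (r : List (Stop x.length)) :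
    ∀ (p : M) {s s' : ℝ}, 0 ≤ s → s ≤ s' → s' ≤ travel o x p r →
      dist (positionAt γ o x p r s) (positionAt γ o x p r s') ≤ s' - s := by
  induction r with
  | nil =>
    intro p s s' h0 h h1
    have := γ.dist_path p o s ⟨h0, h.trans h1⟩ s' ⟨h0.trans h, h1⟩
    simp only [positionAt]
    rw [this, abs_sub_comm, abs_of_nonneg (by linarith)]
  | cons σ r ih =>
    intro p s s' h0 h h1
    simp only [travel] at h1
    rcases le_total (dist p (place x σ)) s with hs | hs
    · rw [positionAt_cons_of_le γ hs, positionAt_cons_of_le γ (hs.trans h)]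
      exact (ih _ (by linarith) (by linarith) (by linarith)).trans_eq (by ring)
    · have e : positionAt γ o x p (σ :: r) s = γ.path p (place x σ) s := by
        simp [positionAt, hs]
      rcases le_total (dist p (place x σ)) s' with hs' | hs'
      · rw [e, positionAt_cons_of_le γ hs']
        have h2 := ih (place x σ) (s := 0) (s' := s' - dist p (place x σ)) le_rfl (by linarith)
          (by linarith)
        rw [positionAt_zero] at h2
        have h3 := γ.dist_path_right p (place x σ) ⟨h0, hs⟩
        refine (dist_triangle _ (place x σ) _).trans ?_
        linarith
      · have e' : positionAt γ o x p (σ :: r) s' = γ.path p (place x σ) s' := by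
          simp [positionAt, hs']
        rw [e, e', γ.dist_path p _ s ⟨h0, hs⟩ s' ⟨h0.trans h, hs'⟩, abs_sub_comm,
          abs_of_nonneg (by linarith)]

theorem dist_positionAt_origin_le {r : List (Stop x.length)} {p : M} {s : ℝ} (h0 : 0 ≤ s)
    (h1 : s ≤ travel o x p r) : dist (positionAt γ o x p r s) o ≤ travel o x p r - s := by
  have := dist_positionAt_le γ r p h0 h1 le_rfl
  rwa [positionAt_travel] at this

/-- The distance to `o` is at most the part travelled and at most the part left, hence at most their
mean. -/
theorem dist_positionAt_origin_le_half {r : List (Stop x.length)} {s : ℝ} (h0 : 0 ≤ s)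
    (h1 : s ≤ travel o x o r) : dist (positionAt γ o x o r s) o ≤ travel o x o r / 2 := by
  have h2 := dist_positionAt_origin_le γ h0 h1
  have h3 := dist_positionAt_le γ r o le_rfl h0 h1
  rw [positionAt_zero, dist_comm] at h3
  linarith

/-- An abandoned tour with its way home is replaced by a genuine route: visiting the performed
prefix and returning is no longer, by the triangle inequality. -/
theorem exists_performed_eq (r : List (Stop x.length)) :
    ∀ (p : M) {s : ℝ}, 0 ≤ s → s ≤ travel o x p r →
      ∃ k, performed x p r s = {σ | σ ∈ r.take k} ∧
        travel o x p (r.take k) ≤ s + dist (positionAt γ o x p r s) o := by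
  induction r with
  | nil =>
    intro p s h0 h1
    refine ⟨0, by simp [performed], ?_⟩
    have h2 := γ.dist_path_left p o ⟨h0, h1⟩
    have := dist_triangle p (γ.path p o s) o
    simp only [positionAt, List.take_zero, travel]
    linarith
  | cons σ r ih =>
    intro p s h0 h1
    simp only [travel] at h1
    rcases le_or_gt (dist p (place x σ)) s with hs | hs
    · obtain ⟨k, hk, hk'⟩ := ih (place x σ) (s := s - dist p (place x σ)) (by linarith)
        (by linarith)
      refine ⟨k + 1, ?_, ?_⟩
      · simp only [performed, if_pos hs, hk]
        ext ρ
        simp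
      · rw [positionAt_cons_of_le γ hs, List.take_succ_cons]
        simp only [travel]
        linarith
    · refine ⟨0, by simp [performed, not_le.2 hs], ?_⟩
      have e : positionAt γ o x p (σ :: r) s = γ.path p (place x σ) s := by
        simp [positionAt, hs.le]
      have h2 := γ.dist_path_left p (place x σ) ⟨h0, hs.le⟩
      have := dist_triangle p (γ.path p (place x σ) s) o
      simp only [e, List.take_zero, travel]
      linarith

theorem performed_travel (r : List (Stop x.length)) :
    ∀ p : M, performed x p r (travel o x p r) = {σ | σ ∈ r} := by
  induction r with
  | nil => intro p; simp [performed]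
  | cons σ r ih =>
    intro p
    have h : dist p (place x σ) ≤ travel o x p (σ :: r) := by
      simpa [travel] using travel_nonneg (o := o) r (place x σ)
    have h' : travel o x p (σ :: r) - dist p (place x σ) = travel o x (place x σ) r := by
      simp [travel]
    simp only [performed, if_pos h, h', ih]
    ext ρ
    simp

end Position

/-! ### Optimal routes and tours, and the moment of turning back -/

section Existence

variable {n : ℕ} {A : Set (Fin n)} {S : Set (Stop n)}

instance : Finite (Stop n) :=
  Finite.of_injective (β := Fin n ⊕ Fin n)
    (fun | .pickup i => Sum.inl i | .deliver i => Sum.inr i)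
    (by rintro (i | i) (j | j) h <;> simp_all)

open Classical in
theorem IsRoute.filter {r : List (Stop n)} (h : IsRoute Set.univ ∅ r) (A : Set (Fin n))
    (S : Set (Stop n)) : IsRoute A S (r.filter fun σ => σ.index ∈ A ∧ σ ∉ S) where
  nodup := h.nodup.filter _
  mem_iff σ := by
    have := h.mem_iff σ
    simp_all
  order := h.order.filter _

theorem exists_isRoute_univ (n : ℕ) : ∃ r : List (Stop n), IsRoute Set.univ ∅ r := by
  refine ⟨(List.finRange n).map .pickup ++ (List.finRange n).map .deliver, ?_, ?_, ?_⟩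
  · refine List.Nodup.append ((List.nodup_finRange n).map fun i j h => by simpa using h)
      ((List.nodup_finRange n).map fun i j h => by simpa using h) ?_
    intro σ h1 h2
    simp only [List.mem_map] at h1 h2
    obtain ⟨i, -, rfl⟩ := h1
    obtain ⟨j, -, h⟩ := h2
    cases h
  · intro σ
    cases σ <;> simp
  · rw [List.pairwise_append]
    refine ⟨?_, ?_, ?_⟩
    · rw [List.pairwise_map]
      exact List.pairwise_of_forall fun i j k h => by cases h.1
    · rw [List.pairwise_map]
      exact List.pairwise_of_forall fun i j k h => by cases h.2
    · intro σ hσ τ hτ i h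
      simp only [List.mem_map] at hσ
      obtain ⟨j, -, rfl⟩ := hσ
      cases h.1

theorem exists_isRoute (A : Set (Fin n)) (S : Set (Stop n)) : ∃ r, IsRoute A S r :=
  (exists_isRoute_univ n).elim fun _ h => ⟨_, h.filter A S⟩

theorem finite_setOf_isRoute (A : Set (Fin n)) (S : Set (Stop n)) : {r | IsRoute A S r}.Finite := by
  have := Fintype.ofFinite (Stop n)
  exact (List.finite_length_le (Stop n) (Fintype.card (Stop n))).subset
    fun r h => h.nodup.length_le_card

theorem exists_isOptimalTour (o : M) (x : List (Request M)) (t : ℝ) (S : Set (Stop x.length)) :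
    ∃ r, IsOptimalTour o x t S r := by
  obtain ⟨r, hr, h⟩ := Set.exists_min_image {r | IsRoute (released x t) S r} (travel o x o)
    (finite_setOf_isRoute _ _) (exists_isRoute _ _)
  exact ⟨r, hr, h⟩

theorem exists_isOptimalRoute (o : M) (x : List (Request M)) : ∃ r, IsOptimalRoute o x r := by
  obtain ⟨r₀, hr₀, h₀⟩ := Set.exists_min_image {r | IsRoute Set.univ ∅ r} (finishTime o x o 0)
    (finite_setOf_isRoute _ _) (exists_isRoute _ _)
  obtain ⟨r, hr, h⟩ := Set.exists_min_image
    {r | IsRoute Set.univ ∅ r ∧ finishTime o x o 0 r = finishTime o x o 0 r₀} (travel o x o)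
    ((finite_setOf_isRoute _ _).subset fun r h => h.1) ⟨r₀, hr₀, rfl⟩
  exact ⟨r, hr.1, fun r' h' => hr.2.trans_le (h₀ r' h'),
    fun r' h1 h2 => h r' ⟨h1, h2.trans hr.2⟩⟩

theorem IsOptimalRoute.finishTime_eq {r : List (Stop x.length)} (h : IsOptimalRoute o x r) :
    finishTime o x o 0 r = optCost o x := by
  symm
  apply IsLeast.csInf_eq
  refine ⟨⟨r, h.route, rfl⟩, ?_⟩
  rintro _ ⟨r', h', rfl⟩
  exact h.earliest r' h'

theorem optCost_le {r : List (Stop x.length)} (h : IsRoute Set.univ ∅ r) :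
    optCost o x ≤ finishTime o x o 0 r := by
  obtain ⟨r₀, h₀⟩ := exists_isOptimalRoute o x
  rw [← h₀.finishTime_eq]
  exact h₀.earliest r h

theorem optCost_nonneg : 0 ≤ optCost o x := by
  obtain ⟨r₀, h₀⟩ := exists_isOptimalRoute o x
  rw [← h₀.finishTime_eq]
  exact le_finishTime _ _ _

theorem time_le_optCost (i : Fin x.length) : (x.get i).time ≤ optCost o x := by
  obtain ⟨r₀, h₀⟩ := exists_isOptimalRoute o x
  rw [← h₀.finishTime_eq]
  exact time_le_finishTime ((h₀.route.mem_iff _).2 (by simp))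

/-- An optimal route restricted to the remaining stops competes with the tour, and its length is at
most its completion time. -/
theorem IsOptimalTour.travel_le_optCost {t : ℝ} {S : Set (Stop x.length)}
    {r : List (Stop x.length)} (h : IsOptimalTour o x t S r) : travel o x o r ≤ optCost o x := by
  obtain ⟨r₀, h₀⟩ := exists_isOptimalRoute o x
  have h1 := h.shortest _ (h₀.route.filter _ _)
  have h2 := add_travel_le_finishTime (o := o) r₀ o 0
  rw [← h₀.finishTime_eq]
  refine h1.trans ((travel_le_of_sublist List.filter_sublist o).trans ?_)
  linarith

/-- The time of getting home depends continuously on the moment of turning back; it runs from `t <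
B` to the end of the tour, beyond `B`. -/
theorem exists_isPlannedEnd (γ : PathSystem M) (o : M) {B t : ℝ} (ht : t < B)
    (r : List (Stop x.length)) : ∃ e, IsPlannedEnd γ o x B t r e := by
  rcases le_or_gt (t + travel o x o r) B with h | h
  · exact ⟨_, Or.inl ⟨h, rfl⟩⟩
  have h0 := travel_nonneg (o := o) r o
  have hc : ContinuousOn (positionAt γ o x o r) (Set.Icc 0 (travel o x o r)) := by
    refine LipschitzOnWith.continuousOn (K := 1) (LipschitzOnWith.of_dist_le_mul ?_)
    intro a ha b hb
    rw [NNReal.coe_one, one_mul, Real.dist_eq]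
    rcases le_total a b with hab | hab
    · rw [abs_sub_comm, abs_of_nonneg (by linarith)]
      exact dist_positionAt_le γ r o ha.1 hab hb.2
    · rw [dist_comm, abs_of_nonneg (by linarith)]
      exact dist_positionAt_le γ r o hb.1 hab ha.2
  have hc' : ContinuousOn (fun e => e + dist (positionAt γ o x o r (e - t)) o)
      (Set.Icc t (t + travel o x o r)) := by
    refine continuousOn_id.add (continuous_dist.comp_continuousOn
      ((hc.comp (by fun_prop) ?_).prodMk continuousOn_const))
    intro e he
    exact ⟨by linarith [he.1], by linarith [he.2]⟩
  have hB : B ∈ Set.Icc (t + dist (positionAt γ o x o r (t - t)) o)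
      ((t + travel o x o r) + dist (positionAt γ o x o r (t + travel o x o r - t)) o) := by
    rw [sub_self, positionAt_zero, add_sub_cancel_left, positionAt_travel, dist_self]
    exact ⟨by linarith, by linarith⟩
  obtain ⟨e, he, heq⟩ := intermediate_value_Icc (by linarith) hc' hB
  exact ⟨e, Or.inr ⟨h, he, heq⟩⟩

end Existence

end Routes

/-! ### Counting the arrivals still to come -/

section Pending

variable {M : Type u} {x : List (Request M)}

theorem deliver_mem_of_unserved_eq_empty {t : ℝ} {S : Set (Stop x.length)}
    (hU : unserved x t S = ∅) {i : Fin x.length} (hi : (x.get i).time ≤ t) :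
    Stop.deliver i ∈ S := by
  by_contra h
  exact (Set.eq_empty_iff_forall_notMem.1 hU i) ⟨hi, h⟩

theorem unserved_eq_empty_of_forall {t : ℝ} {S : Set (Stop x.length)}
    (h : ∀ i, Stop.deliver i ∈ S) : unserved x t S = ∅ :=
  Set.eq_empty_iff_forall_notMem.2 fun i hi => hi.2 (h i)

/-- The number of requests that arrive after time `t`. -/
def pending (x : List (Request M)) (t : ℝ) : ℕ := Set.ncard {i : Fin x.length | t < (x.get i).time}

theorem pending_anti {t t' : ℝ} (h : t ≤ t') : pending x t' ≤ pending x t :=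
  Set.ncard_le_ncard (fun _ hi => h.trans_lt hi) (Set.toFinite _)

theorem pending_lt {t t' : ℝ} {i : Fin x.length} (hi : t < (x.get i).time)
    (hi' : (x.get i).time ≤ t') : pending x t' < pending x t := by
  refine Set.ncard_lt_ncard ⟨fun _ hj => (hi.trans_le hi').trans hj, fun h => ?_⟩ (Set.toFinite _)
  exact (show t' < (x.get i).time from h hi).not_ge hi'

theorem IsNextArrival.pending_lt {t t' : ℝ} (h : IsNextArrival x t t') :
    pending x t' < pending x t := by
  obtain ⟨h, ⟨i, rfl⟩, -⟩ := h
  exact DialARide.pending_lt h le_rfl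

theorem forall_deliver_mem_or_exists_isNextArrival {t : ℝ} {S : Set (Stop x.length)}
    (hU : unserved x t S = ∅) :
    (∀ i, Stop.deliver i ∈ S) ∨ ∃ t', IsNextArrival x t t' := by
  by_cases h : ∃ i, t < (x.get i).time
  · exact Or.inr (h.elim fun i hi => exists_isNextArrival hi)
  · push Not at h
    exact Or.inl fun i => deliver_mem_of_unserved_eq_empty hU (h i)

end Pending

/-! ### Invariants of executions: robustness and consistency -/

section Runs

variable {M : Type u} [MetricSpace M] {γ : PathSystem M} {o : M} {xhat x : List (Request M)}
  {B : ℝ} {That : List (Stop xhat.length)}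

theorem IsNextArrival.le_optCost {t t' : ℝ} (h : IsNextArrival x t t') : t' ≤ optCost o x := by
  obtain ⟨-, ⟨i, rfl⟩, -⟩ := h
  exact time_le_optCost i

theorem IsPlannedEnd.mem_Icc {t e : ℝ} {r : List (Stop x.length)}
    (h : IsPlannedEnd γ o x B t r e) : e ∈ Set.Icc t (t + travel o x o r) := by
  rcases h with ⟨-, rfl⟩ | ⟨-, h, -⟩
  · exact ⟨by linarith [travel_nonneg (o := o) r o], le_rfl⟩
  · exact h

theorem IsPlannedEnd.return_le {t e : ℝ} {r : List (Stop x.length)}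
    (h : IsPlannedEnd γ o x B t r e) : e + dist (positionAt γ o x o r (e - t)) o ≤ B := by
  rcases h with ⟨h, rfl⟩ | ⟨-, -, h⟩
  · rwa [add_sub_cancel_left, positionAt_travel, dist_self, add_zero]
  · exact h.le

/-- A server that turns back earlier gets home no later. -/
theorem return_mono {t a e : ℝ} {r : List (Stop x.length)} (ha : t ≤ a) (hae : a ≤ e)
    (he : e ≤ t + travel o x o r) :
    a + dist (positionAt γ o x o r (a - t)) o ≤ e + dist (positionAt γ o x o r (e - t)) o := by
  have h1 := dist_positionAt_le γ r o (s := a - t) (s' := e - t) (by linarith) (by linarith)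
    (by linarith)
  have h2 := dist_triangle (positionAt γ o x o r (a - t)) (positionAt γ o x o r (e - t)) o
  linarith

theorem return_le_of_lt_time {t e : ℝ} {S : Set (Stop x.length)} {r : List (Stop x.length)}
    (hr : IsOptimalTour o x t S r) (he : e ∈ Set.Icc t (t + travel o x o r))
    {i : Fin x.length} (hi : t < (x.get i).time) :
    leaveTime x t e + dist (positionAt γ o x o r (leaveTime x t e - t)) o
      ≤ 1.5 * optCost o x := by
  have h1 := le_leaveTime (x := x) he.1
  have h2 := leaveTime_le (x := x) t e
  have h3 := leaveTime_le_time e hi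
  have h4 := time_le_optCost (o := o) i
  have h5 := hr.travel_le_optCost
  have h6 := dist_positionAt_origin_le_half γ (r := r) (s := leaveTime x t e - t) (by linarith)
    (by linarith [he.2])
  linarith

theorem deliver_mem_of_complete_tour {t : ℝ} {S : Set (Stop x.length)}
    {r : List (Stop x.length)} (hr : IsRoute (released x t) S r) {i : Fin x.length}
    (hi : (x.get i).time ≤ t) : Stop.deliver i ∈ S ∪ performed x o r (travel o x o r) := by
  rw [performed_travel]
  by_cases h : Stop.deliver i ∈ S
  · exact Or.inl h
  · exact Or.inr ((hr.mem_iff _).2 ⟨hi, h⟩)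

/-- Induction on the execution. The invariant separates states from which another tour may start
from those reached by a last tour, which afford one more optimum. -/
theorem Run.le_of_isRobust {lam : ℝ} (hlam : 0 < lam)
    (hB : B = lam * finishTime o xhat o 0 That)
    {t : ℝ} {z : ℝ} {φ : Phase} {S : Set (Stop x.length)} (h : Run γ o xhat x B That φ t S z) :
    (match φ with
      | .early => t ≤ B ∧ (t ≤ 1.5 * optCost o x ∨
          t ≤ 2.5 * optCost o x ∧ ((∀ i, Stop.deliver i ∈ S) ∨ t = B))
      | .predicted => B ≤ 2.5 * optCost o x ∧ t ≤ 2.5 * optCost o x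
      | .late => t ≤ (2.5 + 2.5 / lam) * optCost o x ∨
          (∀ i, Stop.deliver i ∈ S) ∧ t ≤ (3.5 + 2.5 / lam) * optCost o x) →
    z ≤ (3.5 + 2.5 / lam) * optCost o x := by
  have hC : 0 ≤ optCost o x := optCost_nonneg
  have hD : 0 ≤ 2.5 / lam * optCost o x := by positivity
  induction h with
  | @done φ t S h =>
    cases φ
    · rintro ⟨-, h | h⟩ <;> linarith
    · rintro ⟨-, h⟩; linarith
    · rintro (h | h) <;> linarith
  | earlyWait ht hU hn h next ih =>
    have := hn.le_optCost (o := o)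
    exact fun _ => ih ⟨h.le, Or.inl (by linarith)⟩
  | earlyIdle ht hU hn h next ih =>
    have := hn.le_optCost (o := o)
    exact fun _ => ih ⟨le_rfl, Or.inl (by linarith)⟩
  | @earlyTour t S r e z ht hU hr he next ih =>
    rintro ⟨-, hI⟩
    have he' := he.mem_Icc
    have htC : t ≤ 1.5 * optCost o x := by
      rcases hI with hI | ⟨-, hI | hI⟩
      · exact hI
      · exact absurd (unserved_eq_empty_of_forall hI) hU.ne_empty
      · exact absurd hI ht.ne
    apply ih
    refine ⟨(return_mono (le_leaveTime he'.1) (leaveTime_le _ _) he'.2).trans he.return_le, ?_⟩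
    -- A request still to come keeps the return within 1.5 optima; otherwise the tour is
    -- uninterrupted and ends with all delivered or at `B`.
    by_cases hi : ∃ i, t < (x.get i).time
    · obtain ⟨i, hi⟩ := hi
      exact Or.inl (return_le_of_lt_time hr he' hi)
    · push Not at hi
      right
      rw [leaveTime_eq_of_forall_le hi]
      have hT := hr.travel_le_optCost
      rcases he with ⟨-, rfl⟩ | ⟨h1, h2, h3⟩
      · simp only [add_sub_cancel_left, positionAt_travel, dist_self, add_zero]
        exact ⟨by linarith, Or.inl fun i => deliver_mem_of_complete_tour hr.route (hi i)⟩
      · exact ⟨by linarith, Or.inr h3⟩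
  | switch ht next ih =>
    rintro ⟨h1, h2⟩
    apply ih
    rcases h2 with h2 | h2
    · exact ⟨by linarith, by linarith⟩
    · exact ⟨by linarith, by linarith⟩
  | predictedWait hU hn next ih =>
    have := hn.le_optCost (o := o)
    exact fun h => ih ⟨h.1, by linarith⟩
  | @follow t S z hU next ih =>
    rintro ⟨h1, h2⟩
    apply ih
    left
    have h3 : finishTime o xhat o 0 That ≤ 2.5 / lam * optCost o x := by
      rw [div_mul_eq_mul_div, le_div_iff₀ hlam]
      linarith
    have h4 := finishTime_mono (o := o) That (p := o) h2
    have h5 := finishTime_add_le (o := o) That (δ := 2.5 * optCost o x) (by linarith) o 0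
    rw [zero_add] at h5
    linarith
  | lateWait hU hn next ih =>
    have := hn.le_optCost (o := o)
    exact fun _ => ih (Or.inl (by linarith))
  | @lateTour t S r z hU hr next ih =>
    intro hI
    have htC : t ≤ (2.5 + 2.5 / lam) * optCost o x := by
      rcases hI with hI | ⟨hI, -⟩
      · exact hI
      · exact absurd (unserved_eq_empty_of_forall hI) hU.ne_empty
    apply ih
    by_cases hi : ∃ i, t < (x.get i).time
    · obtain ⟨i, hi⟩ := hi
      have := return_le_of_lt_time (γ := γ) hr
        ⟨by linarith [travel_nonneg (o := o) r o], le_rfl⟩ hi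
      exact Or.inl (by linarith)
    · push Not at hi
      right
      have hT := hr.travel_le_optCost
      rw [leaveTime_eq_of_forall_le hi, add_sub_cancel_left, positionAt_travel, dist_self,
        add_zero]
      exact ⟨fun i => deliver_mem_of_complete_tour hr.route (hi i), by linarith⟩

theorem LADARNID.le_of_pos {lam z : ℝ} (hlam : 0 < lam) (h : LADARNID γ o lam xhat x z) :
    z ≤ (3.5 + 2.5 / lam) * optCost o x := by
  obtain ⟨That, hT, hrun⟩ := h
  have hC : 0 ≤ optCost o x := optCost_nonneg
  exact hrun.le_of_isRobust hlam rfl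
    ⟨mul_nonneg hlam.le (le_finishTime _ _ _), Or.inl (by positivity)⟩

/-- By time `t` a server has performed the stops in `S`, in the order `r`, and has returned to the
origin. -/
structure IsTrace (o : M) (x : List (Request M)) (t : ℝ) (S : Set (Stop x.length))
    (r : List (Stop x.length)) : Prop where
  nodup : r.Nodup
  mem_iff : ∀ σ, σ ∈ r ↔ σ ∈ S
  order : r.Pairwise fun σ τ => ∀ i, ¬ (σ = .deliver i ∧ τ = .pickup i)
  finish_le : finishTime o x o 0 r ≤ t
  pickup_mem : ∀ i, Stop.deliver i ∈ S → Stop.pickup i ∈ S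
  time_le : ∀ σ ∈ S, (x.get σ.index).time ≤ t

theorem IsTrace.mono {t t' : ℝ} {S : Set (Stop x.length)} {r : List (Stop x.length)}
    (h : IsTrace o x t S r) (ht : t ≤ t') : IsTrace o x t' S r :=
  ⟨h.nodup, h.mem_iff, h.order, h.finish_le.trans ht, h.pickup_mem,
    fun σ hσ => (h.time_le σ hσ).trans ht⟩

theorem isTrace_empty : IsTrace o x 0 ∅ [] := by
  constructor <;> simp [finishTime]

theorem IsTrace.optCost_le {t : ℝ} {S : Set (Stop x.length)} {r : List (Stop x.length)}
    (h : IsTrace o x t S r) (hS : ∀ i, Stop.deliver i ∈ S) : optCost o x ≤ t := by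
  refine (DialARide.optCost_le ⟨h.nodup, fun σ => ?_, h.order⟩).trans h.finish_le
  rw [h.mem_iff]
  cases σ with
  | pickup i => simp [h.pickup_mem i (hS i)]
  | deliver i => simp [hS i]

/-- Appends the performed prefix of the tour to the trace. All its stops are released, so no waiting
occurs. -/
theorem IsTrace.tour {t a : ℝ} {S : Set (Stop x.length)} {r q : List (Stop x.length)}
    (h : IsTrace o x t S r) (hq : IsRoute (released x t) S q)
    (ha : a ∈ Set.Icc t (t + travel o x o q)) :
    ∃ r', IsTrace o x (a + dist (positionAt γ o x o q (a - t)) o)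
      (S ∪ performed x o q (a - t)) r' := by
  obtain ⟨k, hk, hk'⟩ := exists_performed_eq γ (o := o) q o (s := a - t) (by linarith [ha.1])
    (by linarith [ha.2])
  have hsub : (q.take k).Sublist q := List.take_sublist k q
  have hmem : ∀ σ ∈ q.take k, (x.get σ.index).time ≤ t ∧ σ ∉ S := fun σ hσ =>
    (hq.mem_iff σ).1 (hsub.subset hσ)
  have hat : t ≤ a + dist (positionAt γ o x o q (a - t)) o := by
    have := ha.1
    have : 0 ≤ dist (positionAt γ o x o q (a - t)) o := dist_nonneg
    linarith
  rw [hk]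
  refine ⟨r ++ q.take k, ?_, ?_, ?_, ?_, ?_, ?_⟩
  · refine List.Nodup.append h.nodup (hq.nodup.sublist hsub) fun σ h1 h2 => ?_
    exact (hmem σ h2).2 ((h.mem_iff σ).1 h1)
  · intro σ
    simp [h.mem_iff]
  · refine List.pairwise_append.2 ⟨h.order, hq.order.sublist hsub, ?_⟩
    rintro σ hσ τ hτ i ⟨rfl, rfl⟩
    exact (hmem _ hτ).2 (h.pickup_mem i ((h.mem_iff _).1 hσ))
  · refine (finishTime_append_le _ _ _ _).trans ((finishTime_mono _ h.finish_le).trans ?_)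
    rw [finishTime_eq_add_travel fun σ hσ => (hmem σ hσ).1]
    linarith
  · rintro i (hi | hi)
    · exact Or.inl (h.pickup_mem i hi)
    · by_cases hS : Stop.pickup i ∈ S
      · exact Or.inl hS
      · right
        -- The tour picks up before delivering, so a prefix with the delivery contains the pickup.
        by_contra hn
        have hp : Stop.pickup i ∈ q := (hq.mem_iff _).2 ⟨(hmem _ hi).1, hS⟩
        have ho := hq.order
        rw [← List.take_append_drop k q] at hp ho
        rcases List.mem_append.1 hp with hp | hp
        · exact hn hp
        · exact (List.pairwise_append.1 ho).2.2 _ hi _ hp i ⟨rfl, rfl⟩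
  · rintro σ (hσ | hσ)
    · exact (h.time_le σ hσ).trans hat
    · exact (hmem σ hσ).1.trans hat

/-- A server that performs only some stops of a route, the first of them a pickup, can perform it
after its release time and still complete in time. -/
theorem exists_late_start {P : Stop x.length → Bool} {r : List (Stop x.length)} :
    ∀ {p : M} {τ : ℝ} {i : Fin x.length} {s : List (Stop x.length)},
      r.filter P = Stop.pickup i :: s →
      ∃ τ', (x.get i).time ≤ τ' ∧
        finishTime o x (place x (Stop.pickup i)) τ' s ≤ finishTime o x p τ r := by
  induction r with
  | nil => simp
  | cons ρ r ih =>
    intro p τ i s h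
    rw [List.filter_cons] at h
    split_ifs at h with hP
    · obtain ⟨rfl, rfl⟩ := List.cons.inj h
      exact ⟨_, le_max_right _ _, finishTime_le_of_sublist List.filter_sublist _ _⟩
    · exact ih h

/-- If the requests from before time `t` can be served by time `B`, and the optimum is close to `t`,
then an optimal route of least length is short. -/
theorem IsOptimalRoute.travel_le {t : ℝ} {S : Set (Stop x.length)} {r T : List (Stop x.length)}
    (hT : IsOptimalRoute o x T) (hr : IsTrace o x B S r) (hBt : B < t)
    (hS : ∀ i, (x.get i).time < t → Stop.deliver i ∈ S) (htC : t ≤ optCost o x)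
    (hclose : B + (optCost o x - t) ≤ t) :
    travel o x o T ≤ B + 2 * (optCost o x - t) := by
  classical
  have hC := hT.finishTime_eq
  set C := optCost o x
  set s := T.filter fun σ => decide (t ≤ (x.get σ.index).time) with hs
  have hsub : s.Sublist T := List.filter_sublist
  have hmem : ∀ σ, σ ∈ s ↔ t ≤ (x.get σ.index).time := by
    intro σ
    simp [hs, hT.route.mem_iff]
  have hmemr : ∀ σ, σ ∈ r ↔ (x.get σ.index).time < t := by
    intro σ
    rw [hr.mem_iff]
    refine ⟨fun h => (hr.time_le σ h).trans_lt hBt, fun h => ?_⟩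
    cases σ with
    | pickup i => exact hr.pickup_mem i (hS i h)
    | deliver i => exact hS i h
  have hroute : IsRoute Set.univ ∅ (r ++ s) := by
    refine ⟨List.Nodup.append hr.nodup (hT.route.nodup.sublist hsub) fun σ h1 h2 => ?_,
      fun σ => ?_, List.pairwise_append.2 ⟨hr.order, hT.route.order.sublist hsub, ?_⟩⟩
    · exact ((hmemr σ).1 h1).not_ge ((hmem σ).1 h2)
    · simp [hmem, hmemr, lt_or_ge]
    · rintro σ hσ τ hτ i ⟨rfl, rfl⟩
      exact ((hmemr (.deliver i)).1 hσ).not_ge ((hmem (.pickup i)).1 hτ)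
  -- The first stop of `s` is a pickup, performed by `T` no earlier than `t`. Hence the rest of `s`
  -- with the way home takes at most `C - t`, and so does the way from `o` to this stop.
  have key : finishTime o x o B s ≤ C ∧ travel o x o s ≤ 2 * (C - t) := by
    rcases hs' : s with - | ⟨σ, s'⟩
    · simp only [finishTime, travel, dist_self, add_zero]
      exact ⟨by linarith, by linarith⟩
    · have hσ : σ ∈ s := by simp [hs']
      obtain ⟨i, rfl⟩ : ∃ i, σ = .pickup i := by
        rcases σ with i | i
        · exact ⟨i, rfl⟩
        · have hp : Stop.pickup i ∈ s := (hmem (.pickup i)).2 ((hmem (.deliver i)).1 hσ)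
          have ho := hT.route.order.sublist hsub
          rw [hs'] at ho hp
          rcases List.mem_cons.1 hp with hp | hp
          · cases hp
          · exact absurd ⟨rfl, rfl⟩ (List.rel_of_pairwise_cons ho hp i)
      obtain ⟨τ', h1, h2⟩ := exists_late_start (o := o) (p := o) (τ := 0) (hs.symm.trans hs')
      rw [hC] at h2
      have h3 := (hmem _).1 hσ
      simp only [Stop.index] at h3
      have h4 := add_travel_le_finishTime (o := o) s' (place x (.pickup i)) τ'
      have h5 := dist_le_travel (o := o) s' (place x (.pickup i))
      rw [dist_comm] at h5
      constructor
      -- Leaving `o` at `B`, the server is at the first pickup by `B + (C - t) ≤ t`, in time for the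
      -- schedule of `T`.
      · refine le_trans (finishTime_mono s' (max_le ?_ h1)) h2
        linarith
      · simp only [travel]
        linarith
  have hfin : finishTime o x o 0 (r ++ s) ≤ C :=
    (finishTime_append_le _ _ _ _).trans ((finishTime_mono _ hr.finish_le).trans key.1)
  have h1 := hT.shortest _ hroute (le_antisymm (hfin.trans_eq hC.symm) (hT.earliest _ hroute))
  have h2 := travel_append_le (o := o) r s o
  have h3 := add_travel_le_finishTime (o := o) r o 0
  have h4 := hr.finish_le
  linarith [key.2]

/-- The early phase carries a trace, frozen at `B`. A wait beyond `B` ends at an arrival, before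
which nothing is left undelivered. -/
theorem Run.le_of_perfect {lam : ℝ} (hlam : lam ∈ Set.Ioc (0 : ℝ) 1)
    {T : List (Stop x.length)} (hT : IsOptimalRoute o x T) (hB : B = lam * optCost o x)
    {t : ℝ} {z : ℝ} {φ : Phase} {S : Set (Stop x.length)} (h : Run γ o x x B T φ t S z) :
    (match φ with
      | .early => t ≤ B ∧ ∃ r, IsTrace o x t S r
      | .predicted => (∃ r, IsTrace o x B S r) ∧
          (t = B ∨ B < t ∧ t ≤ optCost o x ∧ ∀ i, (x.get i).time < t → Stop.deliver i ∈ S)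
      | .late => (∀ i, Stop.deliver i ∈ S) ∧ t ≤ (1.5 + lam) * optCost o x) →
    z ≤ (1.5 + lam) * optCost o x := by
  have hC : 0 ≤ optCost o x := optCost_nonneg
  have hlC : 0 ≤ lam * optCost o x := mul_nonneg hlam.1.le hC
  have hfin := hT.finishTime_eq
  induction h with
  | @done φ t S h =>
    cases φ
    · rintro ⟨h, -⟩; linarith
    · rintro ⟨-, h | h⟩ <;> linarith
    · exact fun h => h.2
  | earlyWait ht hU hn h next ih =>
    rintro ⟨-, r, hr⟩
    exact ih ⟨h.le, r, hr.mono hn.1.le⟩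
  | earlyIdle ht hU hn h next ih =>
    rintro ⟨-, r, hr⟩
    exact ih ⟨le_rfl, r, hr.mono ht.le⟩
  | @earlyTour t S r e z ht hU hr he next ih =>
    rintro ⟨-, r', htr⟩
    have he' := he.mem_Icc
    have h1 := le_leaveTime (x := x) he'.1
    have h2 := leaveTime_le (x := x) t e
    exact ih ⟨(return_mono h1 h2 he'.2).trans he.return_le,
      htr.tour hr.route ⟨h1, h2.trans he'.2⟩⟩
  | switch ht next ih =>
    rintro ⟨h1, r, hr⟩
    exact ih ⟨⟨r, hr.mono h1⟩, Or.inl (le_antisymm h1 ht)⟩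
  | @predictedWait t t' S z hU hn next ih =>
    rintro ⟨hr, h⟩
    refine ih ⟨hr, Or.inr ⟨?_, hn.le_optCost, fun i hi => ?_⟩⟩
    · rcases h with rfl | ⟨h, -⟩
      · exact hn.1
      · exact h.trans hn.1
    · refine deliver_mem_of_unserved_eq_empty hU (le_of_not_gt fun hlt => ?_)
      exact (hn.2.2 i hlt).not_gt hi
  | @follow t S z hU next ih =>
    rintro ⟨⟨r, hr⟩, h⟩
    apply ih
    refine ⟨fun i => Or.inr (List.get_mem x i), ?_⟩
    have h0 : 0 ≤ t := by rcases h with rfl | ⟨h, -⟩ <;> linarith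
    have hadd := finishTime_add_le (o := o) T h0 o 0
    rw [zero_add] at hadd
    rcases h with rfl | ⟨hBt, htC, hS⟩
    · linarith
    -- With optimum `C`: up to the threshold `t + C` suffices; above it `B + 2 * C - t` is below
    -- `1.5 * C`.
    · rcases le_or_gt t ((0.5 + lam) * optCost o x) with h1 | h1
      · linarith
      · have h2 := hT.travel_le hr hBt hS htC (by linarith)
        refine (finishTime_le_max T o 0 t).trans (max_le ?_ ?_) <;> linarith
  | lateWait hU hn next ih =>
    rintro ⟨h, -⟩
    have := hn.le_optCost (o := o)
    exact ih ⟨h, by linarith⟩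
  | lateTour hU hr next ih =>
    rintro ⟨h, -⟩
    exact absurd (unserved_eq_empty_of_forall h) hU.ne_empty

theorem LADARNID.le_of_perfect {lam z : ℝ} (hlam : lam ∈ Set.Ioc (0 : ℝ) 1)
    (h : LADARNID γ o lam x x z) : z ≤ (1.5 + lam) * optCost o x := by
  obtain ⟨T, hT, hrun⟩ := h
  rw [hT.finishTime_eq] at hrun
  exact hrun.le_of_perfect hlam hT rfl
    ⟨mul_nonneg hlam.1.le optCost_nonneg, [], isTrace_empty⟩

end Runs

/-! ### Every instance has a complete execution -/

section Completion

variable {M : Type u} [MetricSpace M] {γ : PathSystem M} {o : M} {xhat x : List (Request M)}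
  {B : ℝ} {That : List (Stop xhat.length)}

theorem tour_progress {t : ℝ} {S : Set (Stop x.length)} {r : List (Stop x.length)}
    (hr : IsRoute (released x t) S r) {t₁ : ℝ} {S₁ : Set (Stop x.length)}
    (ht₁ : t₁ = leaveTime x t (t + travel o x o r)
      + dist (positionAt γ o x o r (leaveTime x t (t + travel o x o r) - t)) o)
    (hS₁ : S₁ = S ∪ performed x o r (leaveTime x t (t + travel o x o r) - t)) :
    pending x t₁ < pending x t ∨ pending x t₁ ≤ pending x t ∧ unserved x t₁ S₁ = ∅ := by
  have h0 := travel_nonneg (o := o) r o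
  rcases leaveTime_eq_or (x := x) t (t + travel o x o r) with h | ⟨i, hi, h⟩
  · rw [h, add_sub_cancel_left] at ht₁ hS₁
    rw [positionAt_travel, dist_self, add_zero] at ht₁
    -- A request may arrive exactly when the tour ends; then it no longer counts as pending.
    by_cases hex : ∃ i, t < (x.get i).time ∧ (x.get i).time ≤ t₁
    · obtain ⟨i, hi, hi'⟩ := hex
      exact Or.inl (pending_lt hi hi')
    · push Not at hex
      refine Or.inr ⟨pending_anti (by linarith), Set.eq_empty_iff_forall_notMem.2 ?_⟩
      rintro i ⟨hi, hi'⟩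
      rw [hS₁] at hi'
      refine hi' (deliver_mem_of_complete_tour hr (le_of_not_gt fun hlt => ?_))
      exact (hex i hlt).not_ge hi
  · refine Or.inl (pending_lt hi ?_)
    rw [ht₁, ← h]
    exact le_add_of_nonneg_right dist_nonneg

theorem exists_run_late (t : ℝ) (S : Set (Stop x.length)) :
    ∃ z, Run γ o xhat x B That .late t S z := by
  induction hn : pending x t using Nat.strong_induction_on generalizing t S with
  | _ n ih =>
    subst hn
    have hempty : ∀ t' S', pending x t' ≤ pending x t → unserved x t' S' = ∅ →
        ∃ z, Run γ o xhat x B That .late t' S' z := by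
      intro t' S' hle hU
      rcases forall_deliver_mem_or_exists_isNextArrival hU with h | ⟨t₁, h⟩
      · exact ⟨_, .done h⟩
      · obtain ⟨z, hz⟩ := ih _ (h.pending_lt.trans_le hle) t₁ S' rfl
        exact ⟨z, .lateWait hU h hz⟩
    rcases Set.eq_empty_or_nonempty (unserved x t S) with hU | hU
    · exact hempty t S le_rfl hU
    · obtain ⟨r, hr⟩ := exists_isOptimalTour o x t S
      rcases tour_progress (γ := γ) hr.route rfl rfl with h | ⟨h, hU'⟩
      · obtain ⟨z, hz⟩ := ih _ h _ _ rfl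
        exact ⟨z, .lateTour hU hr hz⟩
      · obtain ⟨z, hz⟩ := hempty _ _ h hU'
        exact ⟨z, .lateTour hU hr hz⟩

theorem exists_run_predicted (t : ℝ) (S : Set (Stop x.length)) :
    ∃ z, Run γ o xhat x B That .predicted t S z := by
  induction hn : pending x t using Nat.strong_induction_on generalizing t S with
  | _ n ih =>
    subst hn
    rcases Set.eq_empty_or_nonempty (unserved x t S) with hU | hU
    · rcases forall_deliver_mem_or_exists_isNextArrival hU with h | ⟨t', h⟩
      · exact ⟨_, .done h⟩
      · obtain ⟨z, hz⟩ := ih _ h.pending_lt t' S rfl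
        exact ⟨z, .predictedWait hU h hz⟩
    · obtain ⟨z, hz⟩ := exists_run_late (γ := γ) (o := o) (xhat := xhat) (x := x) (B := B)
        (That := That) (finishTime o xhat o t That) (S ∪ {σ | x.get σ.index ∈ xhat})
      exact ⟨z, .follow hU hz⟩

theorem exists_run_early (t : ℝ) (S : Set (Stop x.length)) :
    ∃ z, Run γ o xhat x B That .early t S z := by
  have hswitch : ∀ t S, B ≤ t → ∃ z, Run γ o xhat x B That .early t S z := by
    intro t S ht
    obtain ⟨z, hz⟩ := exists_run_predicted (γ := γ) (o := o) (xhat := xhat) (x := x) (B := B)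
      (That := That) t S
    exact ⟨z, .switch ht hz⟩
  induction hn : pending x t using Nat.strong_induction_on generalizing t S with
  | _ n ih =>
    subst hn
    have hempty : ∀ t' S', pending x t' ≤ pending x t → unserved x t' S' = ∅ →
        ∃ z, Run γ o xhat x B That .early t' S' z := by
      intro t' S' hle hU
      rcases le_or_gt B t' with hB | hB
      · exact hswitch t' S' hB
      rcases forall_deliver_mem_or_exists_isNextArrival hU with h | ⟨t₁, h⟩
      · exact ⟨_, .done h⟩
      · rcases lt_or_ge t₁ B with h₁ | h₁
        · obtain ⟨z, hz⟩ := ih _ (h.pending_lt.trans_le hle) t₁ S' rfl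
          exact ⟨z, .earlyWait hB hU h h₁ hz⟩
        · obtain ⟨z, hz⟩ := hswitch B S' le_rfl
          exact ⟨z, .earlyIdle hB hU h h₁ hz⟩
    rcases le_or_gt B t with hB | hB
    · exact hswitch t S hB
    rcases Set.eq_empty_or_nonempty (unserved x t S) with hU | hU
    · exact hempty t S le_rfl hU
    · obtain ⟨r, hr⟩ := exists_isOptimalTour o x t S
      obtain ⟨e, he⟩ := exists_isPlannedEnd γ o hB r
      suffices h : ∃ z, Run γ o xhat x B That .early
          (leaveTime x t e + dist (positionAt γ o x o r (leaveTime x t e - t)) o)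
          (S ∪ performed x o r (leaveTime x t e - t)) z from
        h.elim fun z hz => ⟨z, .earlyTour hB hU hr he hz⟩
      rcases he with ⟨-, rfl⟩ | ⟨-, -, he⟩
      · rcases tour_progress (γ := γ) hr.route rfl rfl with h | ⟨h, hU'⟩
        · exact ih _ h _ _ rfl
        · exact hempty _ _ h hU'
      · rcases leaveTime_eq_or (x := x) t e with h | ⟨i, hi, h⟩
        -- Without interruption, a tour cut short by the deadline gets home exactly at `B`.
        · apply hswitch
          rw [h, he]
        · refine ih _ (pending_lt hi ?_) _ _ rfl
          rw [← h]
          exact le_add_of_nonneg_right dist_nonneg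

theorem exists_ladarnid (γ : PathSystem M) (o : M) (lam : ℝ) (xhat x : List (Request M)) :
    ∃ z, LADARNID γ o lam xhat x z := by
  obtain ⟨T, hT⟩ := exists_isOptimalRoute o xhat
  obtain ⟨z, hz⟩ := exists_run_early (γ := γ) (o := o) (xhat := xhat) (x := x)
    (B := lam * finishTime o xhat o 0 T) (That := T) 0 ∅
  exact ⟨z, T, hT, hz⟩

end Completion

/-! ### Cost of a wrong prediction -/

section LowerBound

variable {M : Type u} [MetricSpace M] {γ : PathSystem M} {o : M} {xhat : List (Request M)}
  {B : ℝ} {That : List (Stop xhat.length)}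

/-- A delivery by `B` would give a trace beating the optimum. So the predicted route is followed in
vain, and a separate tour to the target comes after it. -/
theorem Run.le_of_unpredicted {q : Request M} (hq : q.time = 0) (hqx : q ∉ xhat) (hB0 : 0 ≤ B)
    (hB : B < optCost o [q]) {t : ℝ} {z : ℝ} {φ : Phase} {S : Set (Stop [q].length)}
    (h : Run γ o xhat [q] B That φ t S z) :
    (match φ with
      | .early => 0 ≤ t ∧ t ≤ B ∧ ∃ r, IsTrace o [q] t S r
      | .predicted => t = B ∧ Stop.deliver 0 ∉ S
      | .late => B + travel o xhat o That + 2 * dist o q.target ≤ t ∨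
          B + travel o xhat o That ≤ t ∧ Stop.deliver 0 ∉ S) →
    B + travel o xhat o That + 2 * dist o q.target ≤ z := by
  have htime : ∀ i, ([q].get i).time = 0 := by
    intro i
    rw [Subsingleton.elim (α := Fin 1) i 0]
    exact hq
  have hnext : ∀ {t t' : ℝ}, IsNextArrival [q] t t' → t < 0 := by
    rintro t t' ⟨h1, ⟨i, rfl⟩, -⟩
    rwa [htime] at h1
  have hall : ∀ {S : Set (Stop [q].length)}, Stop.deliver 0 ∈ S → ∀ i, Stop.deliver i ∈ S := by
    intro S h i
    rwa [Subsingleton.elim (α := Fin 1) i 0]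
  have hL := travel_nonneg (o := o) That o
  induction h with
  | @done φ t S h =>
    cases φ
    · rintro ⟨-, h1, r, hr⟩
      linarith [hr.optCost_le h]
    · exact fun h' => absurd (h _) h'.2
    · rintro (h' | h')
      · exact h'
      · exact absurd (h _) h'.2
  | earlyWait ht hU hn h next ih => exact fun h => absurd (hnext hn) h.1.not_gt
  | earlyIdle ht hU hn h next ih => exact fun h => absurd (hnext hn) h.1.not_gt
  | @earlyTour t S r e z ht hU hr he next ih =>
    rintro ⟨h0, -, r', htr⟩
    have he' := he.mem_Icc
    have h1 := le_leaveTime (x := [q]) he'.1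
    have h2 := leaveTime_le (x := [q]) t e
    refine ih ⟨?_, (return_mono h1 h2 he'.2).trans he.return_le,
      htr.tour hr.route ⟨h1, h2.trans he'.2⟩⟩
    exact add_nonneg (h0.trans h1) dist_nonneg
  | switch ht next ih =>
    rintro ⟨-, h, r, hr⟩
    refine ih ⟨le_antisymm h ht, fun hd => ?_⟩
    linarith [hr.optCost_le (hall hd)]
  | predictedWait hU hn next ih =>
    rintro ⟨rfl, -⟩
    exact absurd (hnext hn) hB0.not_gt
  | follow hU next ih =>
    rintro ⟨rfl, hd⟩
    refine ih (Or.inr ⟨add_travel_le_finishTime _ _ _, ?_⟩)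
    rintro (h | h)
    · exact hd h
    · exact hqx h
  | lateWait hU hn next ih =>
    have hlt := hnext hn
    have : 0 ≤ 2 * dist o q.target := by positivity
    rintro (h | h) <;> linarith
  | @lateTour t S r z hU hr next ih =>
    intro h
    apply ih
    have ht := travel_nonneg (o := o) r o
    left
    rcases h with h | ⟨h, hd⟩
    · have h1 := le_leaveTime (x := [q]) (t := t) (e := t + travel o [q] o r) (by linarith)
      exact h.trans (h1.trans (le_add_of_nonneg_right dist_nonneg))
    · have : 0 ≤ t := by linarith
      rw [leaveTime_eq_of_forall_le fun i => (htime i).trans_le this, add_sub_cancel_left,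
        positionAt_travel, dist_self, add_zero]
      have hmem : Stop.deliver 0 ∈ r :=
        (hr.route.mem_iff _).2 ⟨(htime 0).trans_le this, hd⟩
      have h2 := dist_add_dist_le_travel (o := o) (p := o) hmem
      rw [show place [q] (Stop.deliver 0) = q.target from rfl, dist_comm q.target o] at h2
      linarith

/-- The optimum for a single request at a place, known from the start. -/
theorem optCost_singleton (o a : M) : optCost o [⟨0, a, a⟩] = 2 * dist o a := by
  apply le_antisymm
  · have h : IsRoute (n := 1) Set.univ ∅ [.pickup 0, .deliver 0] := by
      refine ⟨by simp, fun σ => ?_, by simp⟩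
      rcases σ with i | i <;> simp [Subsingleton.elim i 0]
    refine (optCost_le (x := [⟨0, a, a⟩]) h).trans_eq ?_
    simp [finishTime, place, earliest, dist_nonneg, dist_comm a o, two_mul]
  · obtain ⟨r, hr⟩ := exists_isOptimalRoute o [⟨0, a, a⟩]
    have hmem : Stop.deliver 0 ∈ r := (hr.route.mem_iff _).2 (by simp)
    have h1 := dist_add_dist_le_travel (o := o) (p := o) hmem
    have h2 := add_travel_le_finishTime (o := o) r o 0
    rw [hr.finishTime_eq] at h2
    rw [show place [⟨0, a, a⟩] (Stop.deliver 0) = a from rfl, dist_comm a o] at h1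
    linarith

theorem LADARNID.le_of_misplaced {lam z : ℝ} {a b : M} (hlam : 0 ≤ lam) (hab : a ≠ b)
    (h : lam * dist o b < dist o a) (hz : LADARNID γ o lam [⟨0, b, b⟩] [⟨0, a, a⟩] z) :
    lam * (2 * dist o b) + 2 * dist o b + 2 * dist o a ≤ z := by
  obtain ⟨T, hT, hrun⟩ := hz
  have hmem : Stop.deliver 0 ∈ T := (hT.route.mem_iff _).2 (by simp)
  have h1 := dist_add_dist_le_travel (o := o) (p := o) hmem
  rw [show place [⟨0, b, b⟩] (Stop.deliver 0) = b from rfl, dist_comm b o] at h1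
  rw [hT.finishTime_eq, optCost_singleton] at hrun
  have hB : 0 ≤ lam * (2 * dist o b) := by positivity
  have h2 := hrun.le_of_unpredicted rfl (by simpa using hab) hB
    (by rw [optCost_singleton]; linarith) ⟨le_rfl, hB, [], isTrace_empty⟩
  simp only at h2
  linarith

end LowerBound

/-! ### Scalable instances on the line -/

section Line

/-- The shortest paths on the real line. -/
def linePaths : PathSystem (ULift.{u} ℝ) where
  path a b s := ⟨if a.down ≤ b.down then a.down + s else a.down - s⟩
  path_zero a b := by ext; simp
  path_dist a b := by
    ext
    simp only [ULift.dist_eq, Real.dist_eq]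
    split_ifs with h
    · rw [abs_of_nonpos (by linarith)]; ring
    · rw [abs_of_nonneg (by linarith)]; ring
  dist_path a b s _ t _ := by
    simp only [ULift.dist_eq, Real.dist_eq]
    split_ifs
    · congr 1; ring
    · rw [abs_sub_comm]; congr 1; ring

theorem isRequestSequence_singleton {M : Type u} (a b : M) : IsRequestSequence [⟨0, a, b⟩] := by
  simp [IsRequestSequence]

/-- A request is predicted at `b` but occurs at `a`. -/
def lineInput (a b : ℝ) : Input.{u} where
  Space := ULift.{u} ℝ
  paths := linePaths
  origin := ⟨0⟩
  prediction := [⟨0, ⟨b⟩, ⟨b⟩⟩]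
  requests := [⟨0, ⟨a⟩, ⟨a⟩⟩]
  isSeq_prediction := isRequestSequence_singleton _ _
  isSeq_requests := isRequestSequence_singleton _ _

end Line

theorem not_isSmooth {lam : ℝ} (hlam : lam ∈ Set.Ioc (0 : ℝ) 1) {ALG : Input.{u} → ℝ}
    (hALG : ImplementsLADARNID lam ALG) : ¬ IsSmooth (1.5 + lam) ALG := by
  rintro ⟨f, -, -, hf⟩
  obtain ⟨h0, h1⟩ := hlam
  -- The loss beyond the consistency bound will be at least `K / 4`.
  set K := 4 * (|f 1| + 1)
  have hK : f 1 < K / 4 := by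
    have := le_abs_self (f 1)
    simp only [K]
    linarith
  have hK0 : 0 < K := by positivity
  have hlK : 0 < lam * K := by positivity
  -- The factor 1.25 puts the deadline `2 * lam * K` before the optimum `2.5 * lam * K`.
  have ha : dist (⟨0⟩ : ULift.{u} ℝ) ⟨-(1.25 * (lam * K))⟩ = 1.25 * (lam * K) := by
    rw [ULift.dist_eq, Real.dist_eq, zero_sub, neg_neg, abs_of_nonneg (by positivity)]
  have hb : dist (⟨0⟩ : ULift.{u} ℝ) ⟨K⟩ = K := by
    rw [ULift.dist_eq, Real.dist_eq, zero_sub, abs_neg, abs_of_nonneg hK0.le]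
  have hab : (⟨-(1.25 * (lam * K))⟩ : ULift.{u} ℝ) ≠ ⟨K⟩ := by
    intro h
    have := congrArg ULift.down h
    simp only at this
    linarith
  let I : Input.{u} := lineInput (-(1.25 * (lam * K))) K
  have hrun : LADARNID linePaths (⟨0⟩ : ULift.{u} ℝ) lam [⟨0, ⟨K⟩, ⟨K⟩⟩]
      [⟨0, ⟨-(1.25 * (lam * K))⟩, ⟨-(1.25 * (lam * K))⟩⟩] (ALG I) := hALG I
  have hz := LADARNID.le_of_misplaced h0.le hab (by rw [ha, hb]; linarith) hrun
  have hopt : I.opt = 2 * (1.25 * (lam * K)) := by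
    rw [← ha]
    exact optCost_singleton _ _
  have herr : I.error = 1 := by
    refine if_neg fun h => ?_
    exact hab (congrArg Request.source (List.cons.inj h).1).symm
  have hle := hf I
  rw [hopt, herr] at hle
  rw [ha, hb] at hz
  -- The loss is at least `2 * K + 0.75 * lam * K - 2.5 * lam ^ 2 * K`, hence at least `2 * K - 1.75
  -- * lam * K`, hence at least `K / 4`.
  have h2 : lam * (lam * K) ≤ lam * K := mul_le_of_le_one_left hlK.le h1
  have h3 : lam * K ≤ K := mul_le_of_le_one_left hK0.le h1
  linarith

end DialARide

end

theorem mainTheorem12 (lam : ℝ) (hlam : lam ∈ Set.Ioc (0 : ℝ) 1) :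
    (∃ ALG : DialARide.Input.{u} → ℝ, DialARide.ImplementsLADARNID lam ALG) ∧
    ∀ ALG : DialARide.Input.{u} → ℝ, DialARide.ImplementsLADARNID lam ALG →
      DialARide.IsConsistent (1.5 + lam) ALG ∧
      DialARide.IsRobust (3.5 + 2.5 / lam) ALG ∧
      ¬ DialARide.IsSmooth (1.5 + lam) ALG := by
  refine ⟨?_, fun ALG hALG => ⟨fun I hI => ?_, fun I => (hALG I).le_of_pos hlam.1,
    DialARide.not_isSmooth hlam hALG⟩⟩
  · choose ALG hALG using fun I : DialARide.Input.{u} =>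
      DialARide.exists_ladarnid I.paths I.origin lam I.prediction I.requests
    exact ⟨ALG, hALG⟩
  · have h : I.prediction = I.requests := by
      by_contra h
      rw [DialARide.Input.error, if_neg h] at hI
      exact one_ne_zero hI
    have hrun := hALG I
    rw [h] at hrun
    exact hrun.le_of_perfect hlam
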